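/- For $m\in\mathbb{N}=\{1,2,3,\dots\}$ let $$\kappa_{2m}=\frac{2(3m-1)^3}{27(2m-1)},\qquad \kappa_{2m-1}=\frac{2(3m-2)^3}{27(2m-1)}.$$ Let $x$ be a complex number with $\Re(x)>0$. Then the continued fraction $$\frac{x}{2}+\mathop{\mathrm{K}}_{m=1}^{\infty}\Bigl(\frac{\kappa_m}{x}\Bigr)=\frac{x}{2}+\cfrac{\kappa_1}{x+\cfrac{\kappa_2}{x+\cfrac{\kappa_3}{x+\ddots}}}$$ converges (that is, its $n$-th approximants, obtained by stopping after $\kappa_n/x$, tend to a limit in $\mathbb{C}$ as $n\to\infty$), its value is nonzero, and $$\frac{\Gamma^3\bigl(\tfrac12(x+\tfrac23)\bigr)}{\Gamma^3\bigl(\tfrac12(x+\tfrac43)\bigr)}=\cfrac{1}{\dfrac{x}{2}+\mathop{\mathrm{K}}_{m=1}^{\infty}\Bigl(\dfrac{\kappa_m}{x}\Bigr)}.$$ -/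

import Mathlib

/-- The generalized continued fraction `b₀ + K_{n ≥ 1} (a n / b n)` with complex elements,
as an object of Mathlib's type `GenContFract` (its `i`-th pair is `(a (i + 1), b (i + 1))`,
and the values `a 0`, `b 0` are not used). -/
def complexContFract (b₀ : ℂ) (a b : ℕ → ℂ) : GenContFract ℂ where
  h := b₀
  s := Stream'.Seq.ofStream fun i : ℕ => (⟨a (i + 1), b (i + 1)⟩ : GenContFract.Pair ℂ)

/-- `b₀ + K_{n ≥ 1} (a n / b n)` converges to the finite value `v`: with `A n` and `B n` the
canonical numerators and denominators, the approximants `A n / B n` are defined from some `n` on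
and tend to `v`. -/
def ContFractHasValue (b₀ : ℂ) (a b : ℕ → ℂ) (v : ℂ) : Prop :=
  (∀ᶠ n in Filter.atTop, (complexContFract b₀ a b).dens n ≠ 0) ∧
    Filter.Tendsto (fun n => (complexContFract b₀ a b).convs n) Filter.atTop (nhds v)

open Filter Topology ComplexConjugate

/-! For Re x > 0 and positive coefficients, tails in the closed right half-plane stay there. The
energy Re(B_n conj B_(n-1)) / (κ_1 ⋯ κ_n) increases, and κ_n ≤ n² makes it diverge like a harmonic
sum. It controls the spread of approximants over such tails (`dist_modApprox_le`), so the limit v(x)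
exists, does not depend on the tails, and satisfies |v(x) - x/2| ≤ κ_1 / Re x
(`exists_modApprox_limit`).

A Bauer–Muir type transformation (`modApprox_ladder`) turns approximants at x with suitable tails
into multiples of approximants at x + 2, which gives v(x) (x + 4/3)³ = v(x + 2) (x + 2/3)³. The
Gamma quotient G satisfies the reciprocal equation, so v G has period 2. Along x + 2(n + 1), v grows
like n and G decays like 1/n, hence v G = 1 (`limit_mul_gammaCubeQuot`). -/

/-! ### Three-term recurrence; indices are shifted by one, so entry n + 1 is A_n or B_n. -/

/-- The solution of `P (n + 2) = x * P (n + 1) + κ (n + 1) * P n` with initial values `p`, `q`. -/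
def contSeq (x : ℂ) (κ : ℕ → ℂ) (p q : ℂ) : ℕ → ℂ
  | 0 => p
  | 1 => q
  | n + 2 => x * contSeq x κ p q (n + 1) + κ (n + 1) * contSeq x κ p q n

theorem contSeq_zero (x : ℂ) (κ : ℕ → ℂ) (p q : ℂ) : contSeq x κ p q 0 = p := by
  simp [contSeq]

theorem contSeq_one (x : ℂ) (κ : ℕ → ℂ) (p q : ℂ) : contSeq x κ p q 1 = q := by
  simp [contSeq]

theorem contSeq_add_two (x : ℂ) (κ : ℕ → ℂ) (p q : ℂ) (n : ℕ) :
    contSeq x κ p q (n + 2) =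
      x * contSeq x κ p q (n + 1) + κ (n + 1) * contSeq x κ p q n := by
  rw [contSeq]

theorem complexContFract_nums (b₀ x : ℂ) (κ : ℕ → ℂ) (n : ℕ) :
    (complexContFract b₀ κ (fun _ => x)).nums n = contSeq x κ 1 b₀ (n + 1) := by
  have hs : ∀ i, (complexContFract b₀ κ (fun _ => x)).s.get? i = some ⟨κ (i + 1), x⟩ :=
    fun _ => rfl
  induction n using Nat.twoStepInduction with
  | zero => simp [contSeq, complexContFract]
  | one =>
    rw [GenContFract.first_num_eq (hs 0)]
    simp [contSeq, complexContFract]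
  | more n h0 h1 =>
    rw [GenContFract.nums_recurrence (hs (n + 1)) h0 h1, contSeq_add_two x κ 1 b₀ (n + 1)]

theorem complexContFract_dens (b₀ x : ℂ) (κ : ℕ → ℂ) (n : ℕ) :
    (complexContFract b₀ κ (fun _ => x)).dens n = contSeq x κ 0 1 (n + 1) := by
  have hs : ∀ i, (complexContFract b₀ κ (fun _ => x)).s.get? i = some ⟨κ (i + 1), x⟩ :=
    fun _ => rfl
  induction n using Nat.twoStepInduction with
  | zero => simp [contSeq]
  | one =>
    rw [GenContFract.first_den_eq (hs 0)]
    simp [contSeq]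
  | more n h0 h1 =>
    rw [GenContFract.dens_recurrence (hs (n + 1)) h0 h1, contSeq_add_two x κ 0 1 (n + 1)]

/-- The approximant of `b₀ + K (κ n / x)` after `n` steps with tail `w`. -/
noncomputable def modApprox (b₀ x : ℂ) (κ : ℕ → ℂ) (n : ℕ) (w : ℂ) : ℂ :=
  (contSeq x κ 1 b₀ (n + 1) + contSeq x κ 1 b₀ n * w) /
    (contSeq x κ 0 1 (n + 1) + contSeq x κ 0 1 n * w)

theorem modApprox_succ (b₀ x : ℂ) (κ : ℕ → ℂ) (n : ℕ) (w : ℂ) (h : x + w ≠ 0) :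
    modApprox b₀ x κ (n + 1) w = modApprox b₀ x κ n (κ (n + 1) / (x + w)) := by
  unfold modApprox
  rw [contSeq_add_two, contSeq_add_two,
    ← mul_div_mul_right (contSeq x κ 1 b₀ (n + 1) + contSeq x κ 1 b₀ n * (κ (n + 1) / (x + w))) _ h]
  congr 1 <;> field_simp <;> ring

theorem contSeq_wronskian (b₀ x : ℂ) (κ : ℕ → ℂ) (n : ℕ) :
    contSeq x κ 1 b₀ (n + 1) * contSeq x κ 0 1 n - contSeq x κ 1 b₀ n * contSeq x κ 0 1 (n + 1) =
      -∏ i ∈ Finset.range n, -κ (i + 1) := by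
  induction n with
  | zero => simp [contSeq]
  | succ n ih =>
    rw [contSeq_add_two, contSeq_add_two, Finset.prod_range_succ]
    linear_combination (-κ (n + 1)) * ih

/-! ### Convergence in the right half-plane -/

/-- `Re (B n * conj (B (n - 1)))` divided by `κ 1 ⋯ κ n`, for the denominators `B`. -/
noncomputable def denEnergy (x : ℂ) (k : ℕ → ℝ) (n : ℕ) : ℝ :=
  (contSeq x (fun i => (k i : ℂ)) 0 1 (n + 1) *
    conj (contSeq x (fun i => (k i : ℂ)) 0 1 n)).re / ∏ i ∈ Finset.range n, k (i + 1)

section Convergence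

variable {x : ℂ} {k : ℕ → ℝ}

theorem prod_coeff_pos (hk : ∀ n, 0 < k (n + 1)) (n : ℕ) :
    0 < ∏ i ∈ Finset.range n, k (i + 1) := Finset.prod_pos fun i _ => hk i

theorem denEnergy_zero : denEnergy x k 0 = 0 := by
  simp [denEnergy, contSeq]

/-- Multiply the recurrence for B_(n+1) by conj B_n: the cross term has the same real part as B_n
conj B_(n-1), and its factor κ_(n+1) cancels in the normalization. -/
theorem denEnergy_succ (hk : ∀ n, 0 < k (n + 1)) (n : ℕ) :
    denEnergy x k (n + 1) = denEnergy x k n +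
      x.re * (‖contSeq x (fun i => (k i : ℂ)) 0 1 (n + 1)‖ ^ 2 /
        ∏ i ∈ Finset.range (n + 1), k (i + 1)) := by
  unfold denEnergy
  have h1 := prod_coeff_pos hk n
  have h2 := hk n
  rw [contSeq_add_two, Finset.prod_range_succ, Complex.sq_norm, Complex.normSq_apply]
  field_simp
  simp only [Complex.mul_re, Complex.add_re, Complex.add_im, Complex.mul_im, Complex.conj_re,
    Complex.conj_im, Complex.ofReal_re, Complex.ofReal_im]
  ring

theorem denEnergy_one_pos (hk : ∀ n, 0 < k (n + 1)) (hx : 0 < x.re) : 0 < denEnergy x k 1 := by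
  rw [denEnergy_succ hk, denEnergy_zero]
  have := hk 0
  simp only [contSeq, norm_one, Finset.range_one, zero_add]
  simp
  positivity

theorem denEnergy_monotone (hk : ∀ n, 0 < k (n + 1)) (hx : 0 < x.re) :
    Monotone (denEnergy x k) := by
  refine monotone_nat_of_le_succ fun n => ?_
  rw [denEnergy_succ hk]
  have := prod_coeff_pos hk (n + 1)
  have : 0 ≤ x.re * (‖contSeq x (fun i => (k i : ℂ)) 0 1 (n + 1)‖ ^ 2 /
        ∏ i ∈ Finset.range (n + 1), k (i + 1)) := by positivity
  linarith

theorem denEnergy_pos (hk : ∀ n, 0 < k (n + 1)) (hx : 0 < x.re) (n : ℕ) :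
    0 < denEnergy x k (n + 1) :=
  (denEnergy_one_pos hk hx).trans_le (denEnergy_monotone hk hx (by omega))

/-- Two consecutive increments are combined by AM-GM; their geometric mean contains |B_(n+1) B_n|,
which bounds the energy from above. -/
theorem denEnergy_step (hk : ∀ n, 0 < k (n + 1)) (hk' : ∀ n, k (n + 1) ≤ ((n : ℝ) + 1) ^ 2)
    (hx : 0 < x.re) (n : ℕ) :
    denEnergy x k n + 2 * x.re * denEnergy x k 1 * (1 / ((n : ℝ) + 2)) ≤
      denEnergy x k (n + 2) := by
  have hm := denEnergy_monotone hk hx (show 1 ≤ n + 1 by omega)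
  have hPpos := prod_coeff_pos hk (n + 1)
  have hk1 := hk (n + 1)
  have hk2 : k (n + 2) ≤ ((n : ℝ) + 2) ^ 2 := by
    have := hk' (n + 1)
    push_cast at this
    linarith [this, show ((n : ℝ) + 1 + 1) ^ 2 = ((n : ℝ) + 2) ^ 2 by ring]
  have hN : (0 : ℝ) < (n : ℝ) + 2 := by positivity
  rw [denEnergy_succ hk (n + 1), denEnergy_succ hk n]
  have hE : denEnergy x k (n + 1) ≤ ‖contSeq x (fun i => (k i : ℂ)) 0 1 (n + 2)‖ *
      ‖contSeq x (fun i => (k i : ℂ)) 0 1 (n + 1)‖ / ∏ i ∈ Finset.range (n + 1), k (i + 1) := by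
    unfold denEnergy
    gcongr
    refine (Complex.re_le_norm _).trans ?_
    rw [norm_mul, Complex.norm_conj]
  rw [Finset.prod_range_succ _ (n + 1)]
  set p := ‖contSeq x (fun i => (k i : ℂ)) 0 1 (n + 2)‖
  set q := ‖contSeq x (fun i => (k i : ℂ)) 0 1 (n + 1)‖
  set P := ∏ i ∈ Finset.range (n + 1), k (i + 1)
  have h3 : p ^ 2 / (P * ((n : ℝ) + 2) ^ 2) ≤ p ^ 2 / (P * k (n + 1 + 1)) := by
    gcongr
  have h4 : 2 * (p * q / P) * (1 / ((n : ℝ) + 2)) ≤ p ^ 2 / (P * ((n : ℝ) + 2) ^ 2) + q ^ 2 / P := by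
    have : p ^ 2 / (P * ((n : ℝ) + 2) ^ 2) + q ^ 2 / P - 2 * (p * q / P) * (1 / ((n : ℝ) + 2)) =
        (p / ((n : ℝ) + 2) - q) ^ 2 / P := by
      field_simp
      ring
    have h5 : 0 ≤ (p / ((n : ℝ) + 2) - q) ^ 2 / P := by positivity
    linarith
  have h6 : 2 * denEnergy x k 1 * (1 / ((n : ℝ) + 2)) ≤ 2 * (p * q / P) * (1 / ((n : ℝ) + 2)) := by
    gcongr
    exact hm.trans hE
  have h7 := mul_le_mul_of_nonneg_left (h6.trans (h4.trans (add_le_add_left h3 _))) hx.le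
  linarith

theorem denEnergy_tendsto (hk : ∀ n, 0 < k (n + 1)) (hk' : ∀ n, k (n + 1) ≤ ((n : ℝ) + 1) ^ 2)
    (hx : 0 < x.re) : Tendsto (denEnergy x k) atTop atTop := by
  have hc : 0 < 2 * x.re * denEnergy x k 1 :=
    mul_pos (by positivity) (denEnergy_one_pos hk hx)
  -- Adding two neighbouring energies makes the two-step inequality telescope.
  have hsum : ∀ n, 2 * x.re * denEnergy x k 1 *
      (∑ i ∈ Finset.range (n + 1), 1 / ((i : ℝ) + 1) - 1) ≤ 
      denEnergy x k n + denEnergy x k (n + 1) := by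
    intro n
    induction n with
    | zero => simpa [denEnergy_zero] using (denEnergy_one_pos hk hx).le
    | succ n ih =>
      have := denEnergy_step hk hk' hx n
      rw [Finset.sum_range_succ]
      push_cast
      rw [show (n : ℝ) + 1 + 1 = n + 2 by ring]
      linarith
  have hdiv : Tendsto (fun n : ℕ => 2 * x.re * denEnergy x k 1 *
      (∑ i ∈ Finset.range (n + 1), 1 / ((i : ℝ) + 1) - 1) / 2) atTop atTop := by
    refine Tendsto.atTop_div_const two_pos (Tendsto.const_mul_atTop hc ?_)
    exact tendsto_atTop_add_const_right _ _
      (Real.tendsto_sum_range_one_div_nat_succ_atTop.comp (tendsto_add_atTop_nat 1))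
  rw [← tendsto_add_atTop_iff_nat 1]
  refine tendsto_atTop_mono (fun n => ?_) hdiv
  have := denEnergy_monotone hk hx (Nat.le_succ n)
  have := hsum n
  simp only [Nat.succ_eq_add_one] at *
  linarith

theorem contSeq_den_ne_zero (hk : ∀ n, 0 < k (n + 1)) (hx : 0 < x.re) (n : ℕ) :
    contSeq x (fun i => (k i : ℂ)) 0 1 (n + 1) ≠ 0 := by
  intro h
  have := denEnergy_pos hk hx n
  simp [denEnergy, h] at this

/-- The approximant is a Möbius function of its tail with determinant ±κ_1 ⋯ κ_(n+1). Its
denominator is bounded below on the half-plane because projecting onto B' can only gain from a tail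
with Re ≥ 0. -/
theorem dist_modApprox_le (hk : ∀ n, 0 < k (n + 1)) (hx : 0 < x.re) (b₀ : ℂ) (n : ℕ) {w w' : ℂ}
    (hw : 0 ≤ w.re) (hw' : 0 ≤ w'.re) :
    dist (modApprox b₀ x (fun i => (k i : ℂ)) (n + 1) w)
      (modApprox b₀ x (fun i => (k i : ℂ)) (n + 1) w') ≤ 2 / denEnergy x k (n + 1) := by
  have hB := contSeq_den_ne_zero hk hx n
  have hE := denEnergy_pos hk hx n
  have hPpos := prod_coeff_pos hk (n + 1)
  have hW := contSeq_wronskian b₀ x (fun i => (k i : ℂ)) (n + 1)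
  have hnorm : ‖-∏ i ∈ Finset.range (n + 1), -((k (i + 1) : ℝ) : ℂ)‖ =
      ∏ i ∈ Finset.range (n + 1), k (i + 1) := by
    rw [norm_neg, norm_prod]
    refine Finset.prod_congr rfl fun i _ => ?_
    rw [norm_neg, Complex.norm_real, Real.norm_of_nonneg (hk i).le]
  unfold modApprox
  unfold denEnergy at hE ⊢
  set P := ∏ i ∈ Finset.range (n + 1), k (i + 1)
  set A := contSeq x (fun i => (k i : ℂ)) 1 b₀ (n + 1 + 1)
  set A' := contSeq x (fun i => (k i : ℂ)) 1 b₀ (n + 1)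
  set B := contSeq x (fun i => (k i : ℂ)) 0 1 (n + 1 + 1)
  set B' := contSeq x (fun i => (k i : ℂ)) 0 1 (n + 1)
  have hD : 0 < (B * conj B').re := by
    by_contra h
    exact absurd hE (not_lt.mpr (div_nonpos_of_nonpos_of_nonneg (not_lt.mp h) hPpos.le))
  have key : ∀ u : ℂ, 0 ≤ u.re → (B * conj B').re / ‖B'‖ ≤ ‖B + B' * u‖ := by
    intro u hu
    rw [div_le_iff₀ (norm_pos_iff.mpr hB), ← Complex.norm_conj B', ← norm_mul]
    refine le_trans ?_ (Complex.re_le_norm _)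
    have : (B + B' * u) * conj B' = B * conj B' + ((Complex.normSq B' : ℝ) : ℂ) * u := by
      rw [Complex.normSq_eq_conj_mul_self]
      ring
    rw [this, Complex.add_re, Complex.re_ofReal_mul]
    have := Complex.normSq_nonneg B'
    have := mul_nonneg this hu
    linarith
  have hB0 := norm_pos_iff.mpr hB
  have hq : 0 < (B * conj B').re / ‖B'‖ := div_pos hD hB0
  have h1 := key w hw
  have h2 := key w' hw'
  have h1' : B + B' * w ≠ 0 := norm_pos_iff.mp (hq.trans_le h1)
  have h2' : B + B' * w' ≠ 0 := norm_pos_iff.mp (hq.trans_le h2)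
  have hdiff : (A + A' * w) / (B + B' * w) - (A + A' * w') / (B + B' * w') =
      ((A * B' - A' * B) / B') * (1 / (B + B' * w) - 1 / (B + B' * w')) := by
    rw [div_sub_div _ _ h1' h2', div_sub_div _ _ h1' h2', div_mul_div_comm,
      div_eq_div_iff (mul_ne_zero h1' h2') (mul_ne_zero hB (mul_ne_zero h1' h2'))]
    ring
  rw [dist_eq_norm, hdiff, hW, norm_mul, norm_div, hnorm]
  have h3 : ‖1 / (B + B' * w) - 1 / (B + B' * w')‖ ≤ 2 * (‖B'‖ / (B * conj B').re) := by
    refine (norm_sub_le _ _).trans ?_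
    rw [norm_div, norm_div, norm_one, ← one_div_div (B * conj B').re]
    have := one_div_le_one_div_of_le hq h1
    have := one_div_le_one_div_of_le hq h2
    linarith
  calc P / ‖B'‖ * ‖1 / (B + B' * w) - 1 / (B + B' * w')‖
      ≤ P / ‖B'‖ * (2 * (‖B'‖ / (B * conj B').re)) := by gcongr
    _ = 2 / ((B * conj B').re / P) := by field_simp

theorem re_tail_nonneg (hx : 0 < x.re) {c : ℝ} (hc : 0 < c) {w : ℂ} (hw : 0 ≤ w.re) :
    0 ≤ ((c : ℂ) / (x + w)).re := by
  rw [Complex.div_re]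
  have : 0 ≤ (x + w).re := by rw [Complex.add_re]; linarith
  have := Complex.normSq_nonneg (x + w)
  simp only [Complex.ofReal_re, Complex.ofReal_im, zero_mul, zero_div, add_zero]
  positivity

theorem exists_modApprox_eq (hk : ∀ n, 0 < k (n + 1)) (hx : 0 < x.re) (b₀ : ℂ) (n j : ℕ) {w : ℂ}
    (hw : 0 ≤ w.re) : ∃ w' : ℂ, 0 ≤ w'.re ∧ modApprox b₀ x (fun i => (k i : ℂ)) (n + j) w =
      modApprox b₀ x (fun i => (k i : ℂ)) n w' := by
  induction j generalizing w with
  | zero => exact ⟨w, hw, rfl⟩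
  | succ j ih =>
    have hne : x + w ≠ 0 := fun h => by
      have := congrArg Complex.re h
      simp at this
      linarith
    obtain ⟨w', h1, h2⟩ := ih (re_tail_nonneg hx (hk (n + j)) hw)
    exact ⟨w', h1, by rw [← h2, ← add_assoc, modApprox_succ _ _ _ _ _ hne]⟩

theorem exists_modApprox_limit (hk : ∀ n, 0 < k (n + 1))
    (hk' : ∀ n, k (n + 1) ≤ ((n : ℝ) + 1) ^ 2) (hx : 0 < x.re) (b₀ : ℂ) :
    ∃ v : ℂ, (∀ w : ℕ → ℂ, (∀ᶠ n in atTop, 0 ≤ (w n).re) →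
      Tendsto (fun n => modApprox b₀ x (fun i => (k i : ℂ)) n (w n)) atTop (𝓝 v)) ∧
      ‖v - b₀‖ ≤ k 1 / x.re := by
  set S := modApprox b₀ x (fun i => (k i : ℂ))
  have hE : Tendsto (fun n => 2 / denEnergy x k (n + 1)) atTop (𝓝 0) :=
    ((denEnergy_tendsto hk hk' hx).comp (tendsto_add_atTop_nat 1)).const_div_atTop 2
  have hbound : ∀ n N, n ≤ N → ∀ w : ℂ, 0 ≤ w.re →
      dist (S (N + 1) w) (S (n + 1) 0) ≤ 2 / denEnergy x k (n + 1) := by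
    intro n N hnN w hw
    obtain ⟨j, rfl⟩ := Nat.exists_eq_add_of_le hnN
    obtain ⟨w', h1, h2⟩ := exists_modApprox_eq hk hx b₀ (n + 1) j hw
    rw [show n + j + 1 = n + 1 + j by omega]
    simp only [S]
    rw [h2]
    exact dist_modApprox_le hk hx b₀ n h1 le_rfl
  have hcau : CauchySeq fun n => S (n + 1) 0 := by
    refine cauchySeq_of_le_tendsto_0' _ (fun n m hnm => ?_) hE
    rw [dist_comm]
    exact hbound n m hnm 0 le_rfl
  obtain ⟨v, hv⟩ := cauchySeq_tendsto_of_complete hcau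
  refine ⟨v, fun w hw => ?_, ?_⟩
  · rw [← tendsto_add_atTop_iff_nat 1]
    refine hv.congr_dist (squeeze_zero' (Eventually.of_forall fun _ => dist_nonneg) ?_ hE)
    filter_upwards [(tendsto_add_atTop_nat 1).eventually hw] with n hn
    rw [dist_comm]
    exact hbound n n le_rfl _ hn
  · refine le_of_tendsto ((hv.sub_const b₀).norm) (Eventually.of_forall fun n => ?_)
    -- Folding all but the first step into the tail leaves b₀ + κ_1 / (x + w).
    obtain ⟨w, h1, h2⟩ := exists_modApprox_eq hk hx b₀ 1 n (w := 0) le_rfl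
    rw [add_comm n 1]
    simp only [S]
    have hre : x.re ≤ ‖x + w‖ := by
      refine le_trans ?_ (Complex.re_le_norm _)
      rw [Complex.add_re]
      linarith
    have hne : x + w ≠ 0 := norm_pos_iff.mp (hx.trans_le hre)
    have : modApprox b₀ x (fun i => (k i : ℂ)) 1 w - b₀ = (k 1 : ℂ) / (x + w) := by
      simp only [modApprox, contSeq]
      simp
      field_simp
      ring
    rw [h2, this, norm_div, Complex.norm_real, Real.norm_of_nonneg (hk 0).le]
    have := hk 0
    gcongr

end Convergence

/-! ### Contiguity between x and x + 2 -/

section Ladder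

/-- The quotient `(x + 4/3)³ / (8 (x + 1))` in the contiguity relation between `x` and `x + 2`. -/
noncomputable def ladderDen (x : ℂ) : ℂ := (x + 4 / 3) ^ 3 / (8 * (x + 1))

/-- The quotient `(x + 2/3)³ / (8 (x + 1))` in the contiguity relation between `x` and `x + 2`. -/
noncomputable def ladderNum (x : ℂ) : ℂ := (x + 2 / 3) ^ 3 / (8 * (x + 1))

theorem ladder_step_odd {x m : ℂ} (hx : x + 1 ≠ 0) (hm : 2 * m + 1 ≠ 0) (y z : ℂ) :
    (m + 1) * (x * (x * z + 2 * (3 * m + 1) ^ 3 / (27 * (2 * m + 1)) * y) +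
          2 * (3 * m + 2) ^ 3 / (27 * (2 * m + 1)) * z) +
        ((m + 1) ^ 2 - x / 2 * (m + 1) + ladderNum x) *
          (x * z + 2 * (3 * m + 1) ^ 3 / (27 * (2 * m + 1)) * y) =
      (x + 2) * ((m ^ 2 + (x + 2) / 2 * m + ladderDen x) * z + (m + 1 / 3) ^ 3 * y) +
        2 * (3 * m + 1) ^ 3 / (27 * (2 * m + 1)) *
          (m * z + (m ^ 2 - x / 2 * m + ladderNum x) * y) := by
  -- Making the denominator 2m + 1 an atom lets `field_simp` clear it.
  obtain ⟨N, rfl⟩ : ∃ N, m = (N - 1) / 2 := ⟨2 * m + 1, by ring⟩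
  rw [show 2 * ((N - 1) / 2) + 1 = N by ring] at *
  unfold ladderNum ladderDen
  field_simp
  ring

theorem ladder_step_even {x m : ℂ} (hx : x + 1 ≠ 0) (hm : 2 * m + 1 ≠ 0) (y z : ℂ) :
    ((m + 1) ^ 2 + (x + 2) / 2 * (m + 1) + ladderDen x) *
          (x * (x * z + 2 * (3 * m + 1) ^ 3 / (27 * (2 * m + 1)) * y) +
            2 * (3 * m + 2) ^ 3 / (27 * (2 * m + 1)) * z) +
        (m + 1 + 1 / 3) ^ 3 * (x * z + 2 * (3 * m + 1) ^ 3 / (27 * (2 * m + 1)) * y) =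
      (x + 2) * ((m + 1) * (x * (x * z + 2 * (3 * m + 1) ^ 3 / (27 * (2 * m + 1)) * y) +
            2 * (3 * m + 2) ^ 3 / (27 * (2 * m + 1)) * z) +
          ((m + 1) ^ 2 - x / 2 * (m + 1) + ladderNum x) *
            (x * z + 2 * (3 * m + 1) ^ 3 / (27 * (2 * m + 1)) * y)) +
        2 * (3 * m + 2) ^ 3 / (27 * (2 * m + 1)) *
          ((m ^ 2 + (x + 2) / 2 * m + ladderDen x) * z + (m + 1 / 3) ^ 3 * y) := by
  obtain ⟨N, rfl⟩ : ∃ N, m = (N - 1) / 2 := ⟨2 * m + 1, by ring⟩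
  rw [show 2 * ((N - 1) / 2) + 1 = N by ring] at *
  unfold ladderNum ladderDen
  field_simp
  ring

variable {κ : ℕ → ℂ}

/-- Combinations of two neighbouring terms at x satisfy the recurrence at x + 2; `c` absorbs the
initial values. -/
theorem contSeq_ladder
    (hodd : ∀ m : ℕ, κ (2 * m + 1) = 2 * (3 * (m : ℂ) + 1) ^ 3 / (27 * (2 * (m : ℂ) + 1)))
    (heven : ∀ m : ℕ, κ (2 * m + 2) = 2 * (3 * (m : ℂ) + 2) ^ 3 / (27 * (2 * (m : ℂ) + 1)))
    {x : ℂ} (hx : x + 1 ≠ 0) {p q p' q' c : ℂ}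
    (h1 : ladderDen x * q + (1 / 27) * p = c * q') (h0 : ladderNum x * p = c * p') (m : ℕ) :
    ((m : ℂ) ^ 2 + (x + 2) / 2 * m + ladderDen x) * contSeq x κ p q (2 * m + 1) +
        ((m : ℂ) + 1 / 3) ^ 3 * contSeq x κ p q (2 * m) =
      c * contSeq (x + 2) κ p' q' (2 * m + 1) ∧
    (m : ℂ) * contSeq x κ p q (2 * m + 1) +
        ((m : ℂ) ^ 2 - x / 2 * m + ladderNum x) * contSeq x κ p q (2 * m) =
      c * contSeq (x + 2) κ p' q' (2 * m) := by
  induction m with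
  | zero =>
    simp only [Nat.cast_zero, mul_zero, zero_add, contSeq_zero, contSeq_one]
    constructor
    · linear_combination h1
    · linear_combination h0
  | succ m ih =>
    obtain ⟨ih1, ih0⟩ := ih
    have hm : 2 * (m : ℂ) + 1 ≠ 0 := by exact_mod_cast (by omega : 2 * m + 1 ≠ 0)
    have hV : ((m + 1 : ℕ) : ℂ) * contSeq x κ p q (2 * m + 3) +
        (((m + 1 : ℕ) : ℂ) ^ 2 - x / 2 * (m + 1 : ℕ) + ladderNum x) * contSeq x κ p q (2 * m + 2) =
      c * contSeq (x + 2) κ p' q' (2 * m + 2) := by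
      rw [contSeq_add_two (x + 2), mul_add c, mul_left_comm c, mul_left_comm c, ← ih1, ← ih0,
        contSeq_add_two x κ p q (2 * m + 1), contSeq_add_two x κ p q (2 * m), hodd, heven]
      push_cast
      exact ladder_step_odd hx hm _ _
    refine ⟨?_, hV⟩
    rw [show 2 * (m + 1) + 1 = 2 * m + 1 + 2 by ring, show 2 * (m + 1) = 2 * m + 2 by ring,
      contSeq_add_two (x + 2), mul_add c, mul_left_comm c, mul_left_comm c, ← ih1, ← hV,
      contSeq_add_two x κ p q (2 * m + 1), contSeq_add_two x κ p q (2 * m), hodd, heven]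
    push_cast
    exact ladder_step_even hx hm _ _

/-- Numerators scale by `ladderNum x` and denominators by `ladderDen x`; the tail is the ratio of
the two coefficients in the first relation of `contSeq_ladder`. -/
theorem modApprox_ladder
    (hodd : ∀ m : ℕ, κ (2 * m + 1) = 2 * (3 * (m : ℂ) + 1) ^ 3 / (27 * (2 * (m : ℂ) + 1)))
    (heven : ∀ m : ℕ, κ (2 * m + 2) = 2 * (3 * (m : ℂ) + 2) ^ 3 / (27 * (2 * (m : ℂ) + 1)))
    {x : ℂ} (hx : x + 1 ≠ 0) (m : ℕ)
    (hm : (m : ℂ) ^ 2 + (x + 2) / 2 * m + ladderDen x ≠ 0) :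
    modApprox (x / 2) x κ (2 * m)
        (((m : ℂ) + 1 / 3) ^ 3 / ((m : ℂ) ^ 2 + (x + 2) / 2 * m + ladderDen x)) =
      ladderNum x / ladderDen x * modApprox ((x + 2) / 2) (x + 2) κ (2 * m) 0 := by
  have hA := (contSeq_ladder hodd heven hx (p := 1) (q := x / 2) (p' := 1) (q' := (x + 2) / 2)
    (c := ladderNum x) (by unfold ladderNum ladderDen; field_simp; ring) rfl m).1
  have hB := (contSeq_ladder hodd heven hx (p := 0) (q := 1) (p' := 0) (q' := 1)
    (c := ladderDen x) (by ring) (by ring) m).1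
  unfold modApprox
  rw [mul_zero, mul_zero, add_zero, add_zero, div_mul_div_comm, ← hA, ← hB,
    ← mul_div_mul_left _ _ hm]
  generalize (m : ℂ) ^ 2 + (x + 2) / 2 * m + ladderDen x = D at hm ⊢
  congr 1 <;> field_simp

end Ladder

/-! ### Functional equation and asymptotics of the Gamma quotient -/

section GammaQuotient

/-- The cubed quotient of Gamma values. -/
noncomputable def gammaCubeQuot (x : ℂ) : ℂ :=
  Complex.Gamma ((x + 2 / 3) / 2) ^ 3 / Complex.Gamma ((x + 4 / 3) / 2) ^ 3

theorem gammaCubeQuot_add_two {x : ℂ} (hx : 0 < x.re) :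
    gammaCubeQuot (x + 2) * (x + 4 / 3) ^ 3 = gammaCubeQuot x * (x + 2 / 3) ^ 3 := by
  have hne : ∀ r : ℝ, 0 < r → (x + r) / 2 ≠ 0 ∧ 0 < ((x + r) / 2).re := by
    intro r hr
    have : 0 < ((x + r) / 2).re := by simp; linarith
    exact ⟨fun h => by simp [h] at this, this⟩
  obtain ⟨h1, h1'⟩ := hne (2 / 3) (by norm_num)
  obtain ⟨h2, h2'⟩ := hne (4 / 3) (by norm_num)
  push_cast at h1 h1' h2 h2'
  have g2 := Complex.Gamma_ne_zero_of_re_pos h2'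
  unfold gammaCubeQuot
  rw [show (x + 2 + 2 / 3) / 2 = (x + 2 / 3) / 2 + 1 by ring,
    show (x + 2 + 4 / 3) / 2 = (x + 4 / 3) / 2 + 1 by ring, Complex.Gamma_add_one _ h1,
    Complex.Gamma_add_one _ h2]
  have h3 : x * 3 + 4 ≠ 0 := fun h => h2 (by linear_combination h / 6)
  field_simp

theorem Gamma_add_nat_add_one {s : ℂ} (hs : 0 < s.re) (n : ℕ) :
    Complex.Gamma (s + n + 1) = (∏ j ∈ Finset.range (n + 1), (s + j)) * Complex.Gamma s := by
  have hne : ∀ n : ℕ, s + n ≠ 0 := fun n h => by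
    have := congrArg Complex.re h
    simp at this
    have : (0 : ℝ) ≤ n := n.cast_nonneg
    linarith
  induction n with
  | zero => simpa using Complex.Gamma_add_one s (by simpa using hne 0)
  | succ n ih =>
    rw [Finset.prod_range_succ, Complex.Gamma_add_one _ (by exact_mod_cast hne (n + 1))]
    push_cast
    rw [← add_assoc, ih]
    ring

theorem tendsto_cpow_mul_factorial_div_Gamma {s : ℂ} (hs : 0 < s.re) :
    Tendsto (fun n : ℕ => (n : ℂ) ^ s * n.factorial / Complex.Gamma (s + n + 1)) atTop (𝓝 1) := by
  have hg := Complex.Gamma_ne_zero_of_re_pos hs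
  have h := (Complex.GammaSeq_tendsto_Gamma s).div_const (Complex.Gamma s)
  rw [div_self hg] at h
  refine h.congr fun n => ?_
  rw [Gamma_add_nat_add_one hs, Complex.GammaSeq, div_div]

/-- By Euler's limit Γ(s + n + 1) ~ n^s n!; the two arguments differ by 1/3, and cubing yields
exactly n. -/
theorem tendsto_gammaCubeQuot {x : ℂ} (hx : 0 < x.re) :
    Tendsto (fun n : ℕ => gammaCubeQuot (x + 2 * (n + 1 : ℕ)) * n) atTop (𝓝 1) := by
  have h1 : 0 < ((x + 2 / 3) / 2).re := by
    have : (x + 2 / 3) / 2 = (((2 : ℝ)⁻¹ : ℝ) : ℂ) * (x + ((2 / 3 : ℝ) : ℂ)) := by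
      push_cast; ring
    rw [this, Complex.re_ofReal_mul, Complex.add_re, Complex.ofReal_re]
    positivity
  have h2 : 0 < ((x + 4 / 3) / 2).re := by
    have : (x + 4 / 3) / 2 = (((2 : ℝ)⁻¹ : ℝ) : ℂ) * (x + ((4 / 3 : ℝ) : ℂ)) := by
      push_cast; ring
    rw [this, Complex.re_ofReal_mul, Complex.add_re, Complex.ofReal_re]
    positivity
  have h := ((tendsto_cpow_mul_factorial_div_Gamma h2).div
    (tendsto_cpow_mul_factorial_div_Gamma h1) one_ne_zero).pow 3
  rw [div_one, one_pow] at h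
  refine h.congr' ?_
  filter_upwards [eventually_ge_atTop 1] with n hn
  have hn0 : (n : ℂ) ≠ 0 := by exact_mod_cast (by omega : n ≠ 0)
  have hf : (n.factorial : ℂ) ≠ 0 := by exact_mod_cast n.factorial_ne_zero
  have hp : (n : ℂ) ^ ((x + 4 / 3) / 2) = (n : ℂ) ^ ((x + 2 / 3) / 2) * (n : ℂ) ^ (1 / 3 : ℂ) := by
    rw [← Complex.cpow_add _ _ hn0]
    congr 1
    ring
  have hc : ((n : ℂ) ^ (1 / 3 : ℂ)) ^ 3 = n := by
    rw [← Complex.cpow_nat_mul]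
    norm_num
  have hp0 : (n : ℂ) ^ ((x + 2 / 3) / 2) ≠ 0 := by simp [Complex.cpow_eq_zero_iff, hn0]
  have hpos : ∀ s : ℂ, 0 < s.re → Complex.Gamma (s + n + 1) ≠ 0 := fun s hs => by
    refine Complex.Gamma_ne_zero_of_re_pos ?_
    simp
    positivity
  have e1 := hpos _ h1
  have e2 := hpos _ h2
  unfold gammaCubeQuot
  rw [show (x + 2 * (n + 1 : ℕ) + 2 / 3) / 2 = (x + 2 / 3) / 2 + n + 1 by push_cast; ring,
    show (x + 2 * (n + 1 : ℕ) + 4 / 3) / 2 = (x + 4 / 3) / 2 + n + 1 by push_cast; ring]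
  simp only [Pi.div_apply, hp]
  set G1 := Complex.Gamma ((x + 2 / 3) / 2 + n + 1)
  set G2 := Complex.Gamma ((x + 4 / 3) / 2 + n + 1)
  set c := (n : ℂ) ^ (1 / 3 : ℂ)
  set a := (n : ℂ) ^ ((x + 2 / 3) / 2)
  rw [← hc]
  field_simp

end GammaQuotient

/-! ### The specific coefficients and the conclusion -/

/-- The partial numerators, as real numbers. -/
noncomputable def cubicCoeff (n : ℕ) : ℝ :=
  if Even n then (3 * n - 2) ^ 3 / (108 * (n - 1)) else (3 * n - 1) ^ 3 / (108 * n)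

theorem cubicCoeff_odd (m : ℕ) :
    cubicCoeff (2 * m + 1) = 2 * (3 * (m : ℝ) + 1) ^ 3 / (27 * (2 * m + 1)) := by
  rw [cubicCoeff, if_neg (by simp)]
  push_cast
  field_simp
  ring

theorem cubicCoeff_even (m : ℕ) :
    cubicCoeff (2 * m + 2) = 2 * (3 * (m : ℝ) + 2) ^ 3 / (27 * (2 * m + 1)) := by
  rw [cubicCoeff, if_pos (by simp [parity_simps])]
  push_cast
  rw [show 2 * (m : ℝ) + 2 - 1 = 2 * m + 1 by ring]
  field_simp
  ring

theorem cubicCoeff_bounds (n : ℕ) :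
    0 < cubicCoeff (n + 1) ∧ cubicCoeff (n + 1) ≤ ((n : ℝ) + 1) ^ 2 := by
  rcases Nat.even_or_odd' n with ⟨m, rfl | rfl⟩
  · rw [cubicCoeff_odd]
    refine ⟨by positivity, ?_⟩
    rw [div_le_iff₀ (by positivity)]
    have : (0 : ℝ) ≤ m := m.cast_nonneg
    push_cast
    have : 0 ≤ (m : ℝ) ^ 2 := by positivity
    have : 0 ≤ (m : ℝ) ^ 3 := by positivity
    nlinarith
  · rw [show 2 * m + 1 + 1 = 2 * m + 2 by ring, cubicCoeff_even]
    refine ⟨by positivity, ?_⟩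
    rw [div_le_iff₀ (by positivity)]
    have : (0 : ℝ) ≤ m := m.cast_nonneg
    push_cast
    have : 0 ≤ (m : ℝ) ^ 2 := by positivity
    have : 0 ≤ (m : ℝ) ^ 3 := by positivity
    nlinarith

theorem eventually_re_tail_nonneg (x q : ℂ) (hx : 0 < x.re) :
    ∀ᶠ m : ℕ in atTop, (m : ℂ) ^ 2 + (x + 2) / 2 * m + q ≠ 0 ∧
      0 ≤ (((m : ℂ) + 1 / 3) ^ 3 / ((m : ℂ) ^ 2 + (x + 2) / 2 * m + q)).re := by
  filter_upwards [eventually_gt_atTop ⌈‖q‖⌉₊, eventually_ge_atTop 1] with m hm hm1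
  have h1 : ‖q‖ < m := Nat.lt_of_ceil_lt hm
  have h1' : (1 : ℝ) ≤ m := by exact_mod_cast hm1
  have h2 : -‖q‖ ≤ q.re := (abs_le.mp (Complex.abs_re_le_norm q)).1
  have h3 : 0 < ((m : ℂ) ^ 2 + (x + 2) / 2 * m + q).re := by
    have : (m : ℂ) ^ 2 + (x + 2) / 2 * m + q =
        ((m ^ 2 + m : ℝ) : ℂ) + ((m / 2 : ℝ) : ℂ) * x + q := by push_cast; ring
    rw [this, Complex.add_re, Complex.add_re, Complex.ofReal_re, Complex.re_ofReal_mul]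
    have : 0 < (m : ℝ) / 2 * x.re := by positivity
    nlinarith
  refine ⟨fun h => by simp [h] at h3, ?_⟩
  have : ((m : ℂ) + 1 / 3) ^ 3 = (((m + 1 / 3 : ℝ) ^ 3 : ℝ) : ℂ) := by push_cast; ring
  rw [this, Complex.div_re, Complex.ofReal_re, Complex.ofReal_im, zero_mul, zero_div, add_zero]
  have := Complex.normSq_nonneg ((m : ℂ) ^ 2 + (x + 2) / 2 * m + q)
  positivity

theorem limit_mul_gammaCubeQuot {v : ℂ → ℂ}
    (hv : ∀ x : ℂ, 0 < x.re → v (x + 2) * (x + 2 / 3) ^ 3 = v x * (x + 4 / 3) ^ 3)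
    {C : ℝ} (hC : ∀ x : ℂ, 0 < x.re → ‖v x - x / 2‖ ≤ C / x.re) {x : ℂ} (hx : 0 < x.re) :
    v x * gammaCubeQuot x = 1 := by
  have hre : ∀ n : ℕ, (x + 2 * n).re = x.re + 2 * n := fun n => by simp
  have hpos : ∀ n : ℕ, 0 < (x + 2 * n).re := fun n => by rw [hre]; positivity
  have hinv : ∀ n : ℕ, v (x + 2 * n) * gammaCubeQuot (x + 2 * n) = v x * gammaCubeQuot x := by
    intro n
    induction n with
    | zero => simp
    | succ n ih =>
      rw [← ih, show x + 2 * ((n + 1 : ℕ) : ℂ) = x + 2 * n + 2 by push_cast; ring]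
      have h1 := hv _ (hpos n)
      have h2 := gammaCubeQuot_add_two (hpos n)
      have hne : ∀ r : ℝ, 0 < r → x + 2 * n + r ≠ 0 := fun r hr h => by
        have := congrArg Complex.re h
        rw [Complex.add_re, Complex.ofReal_re, Complex.zero_re] at this
        linarith [hpos n]
      have h3 := hne (2 / 3) (by norm_num)
      have h4 := hne (4 / 3) (by norm_num)
      push_cast at h3 h4
      refine mul_right_cancel₀ (mul_ne_zero (pow_ne_zero 3 h3) (pow_ne_zero 3 h4)) ?_
      linear_combination (gammaCubeQuot (x + 2 * n + 2) * (x + 2 * n + 4 / 3) ^ 3) * h1 +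
        (v (x + 2 * n) * (x + 2 * n + 4 / 3) ^ 3) * h2
  have hquot : Tendsto (fun n : ℕ => v (x + 2 * (n + 1 : ℕ)) / n) atTop (𝓝 1) := by
    have e0 : Tendsto (fun n : ℕ => ((n : ℂ))⁻¹) atTop (𝓝 0) :=
      tendsto_inv_atTop_nhds_zero_nat (𝕜 := ℂ)
    have e1 : Tendsto (fun n : ℕ => (x / 2 + 1) * ((n : ℂ))⁻¹ + 1) atTop (𝓝 1) := by
      simpa using (e0.const_mul (x / 2 + 1)).add_const 1
    -- Only boundedness of v(y) - y/2 along y = x + 2(n + 1) is used here.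
    have e2 : Tendsto (fun n : ℕ => (v (x + 2 * (n + 1 : ℕ)) - (x + 2 * (n + 1 : ℕ)) / 2) *
        ((n : ℂ))⁻¹) atTop (𝓝 0) := by
      refine squeeze_zero_norm (a := fun n : ℕ => |C| / x.re * ‖((n : ℂ))⁻¹‖) (fun n => ?_) ?_
      · rw [norm_mul]
        gcongr
        refine (hC _ (hpos (n + 1))).trans ?_
        refine div_le_div₀ (abs_nonneg C) (le_abs_self C) hx ?_
        rw [hre]
        have : (0 : ℝ) ≤ (n + 1 : ℕ) := Nat.cast_nonneg _
        linarith
      · simpa using e0.norm.const_mul (|C| / x.re)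
    have e3 := e2.add e1
    rw [zero_add] at e3
    refine e3.congr' ?_
    filter_upwards [eventually_ge_atTop 1] with n hn
    have hn0 : (n : ℂ) ≠ 0 := by exact_mod_cast (by omega : n ≠ 0)
    push_cast
    field_simp
    ring
  have hlim := hquot.mul (tendsto_gammaCubeQuot hx)
  rw [one_mul] at hlim
  refine tendsto_nhds_unique (tendsto_const_nhds.congr' ?_) hlim
  filter_upwards [eventually_ge_atTop 1] with n hn
  have hn0 : (n : ℂ) ≠ 0 := by exact_mod_cast (by omega : n ≠ 0)
  rw [← hinv (n + 1)]
  field_simp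

theorem corollary2 (κ : ℕ → ℂ)
    (hκ_even : ∀ m : ℕ, 1 ≤ m →
      κ (2 * m) = 2 * (3 * (m : ℂ) - 1) ^ 3 / (27 * (2 * (m : ℂ) - 1)))
    (hκ_odd : ∀ m : ℕ, 1 ≤ m →
      κ (2 * m - 1) = 2 * (3 * (m : ℂ) - 2) ^ 3 / (27 * (2 * (m : ℂ) - 1)))
    (x : ℂ) (hx : 0 < x.re) :
    ∃ v : ℂ, ContFractHasValue (x / 2) κ (fun _ => x) v ∧ v ≠ 0 ∧
      Complex.Gamma ((x + 2 / 3) / 2) ^ 3 / Complex.Gamma ((x + 4 / 3) / 2) ^ 3 = 1 / v := by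
  have hodd : ∀ m : ℕ, κ (2 * m + 1) = 2 * (3 * (m : ℂ) + 1) ^ 3 / (27 * (2 * (m : ℂ) + 1)) := by
    intro m
    have := hκ_odd (m + 1) (by omega)
    rw [show 2 * (m + 1) - 1 = 2 * m + 1 by omega] at this
    rw [this]
    push_cast
    ring_nf
  have heven : ∀ m : ℕ, κ (2 * m + 2) = 2 * (3 * (m : ℂ) + 2) ^ 3 / (27 * (2 * (m : ℂ) + 1)) := by
    intro m
    have := hκ_even (m + 1) (by omega)
    rw [show 2 * (m + 1) = 2 * m + 2 by omega] at this
    rw [this]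
    push_cast
    ring_nf
  -- `κ 0` is unconstrained, so κ and κ' are compared only from index 1 on.
  set κ' : ℕ → ℂ := fun i => (cubicCoeff i : ℂ) with hκ'
  have hodd' : ∀ m : ℕ, κ' (2 * m + 1) =
      2 * (3 * (m : ℂ) + 1) ^ 3 / (27 * (2 * (m : ℂ) + 1)) := fun m => by
    rw [hκ']
    simp only [cubicCoeff_odd]
    push_cast
    rfl
  have heven' : ∀ m : ℕ, κ' (2 * m + 2) =
      2 * (3 * (m : ℂ) + 2) ^ 3 / (27 * (2 * (m : ℂ) + 1)) := fun m => by
    rw [hκ']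
    simp only [cubicCoeff_even]
    push_cast
    rfl
  have hcoe : ∀ n, κ (n + 1) = κ' (n + 1) := by
    intro n
    rcases Nat.even_or_odd' n with ⟨m, rfl | rfl⟩
    · rw [hodd, hodd']
    · rw [show 2 * m + 1 + 1 = 2 * m + 2 by ring, heven, heven']
  have hcont : complexContFract (x / 2) κ (fun _ => x) =
      complexContFract (x / 2) κ' (fun _ => x) := by
    unfold complexContFract
    simp only [hcoe]
  have hk : ∀ n, 0 < cubicCoeff (n + 1) := fun n => (cubicCoeff_bounds n).1
  have hk' : ∀ n, cubicCoeff (n + 1) ≤ ((n : ℝ) + 1) ^ 2 := fun n => (cubicCoeff_bounds n).2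
  -- Re y > 0 sits inside the existential so that `choose` gives a total function v.
  have hex : ∀ y : ℂ, ∃ v : ℂ, 0 < y.re → (∀ w : ℕ → ℂ, (∀ᶠ n in atTop, 0 ≤ (w n).re) →
      Tendsto (fun n => modApprox (y / 2) y κ' n (w n)) atTop (𝓝 v)) ∧
      ‖v - y / 2‖ ≤ cubicCoeff 1 / y.re := by
    intro y
    by_cases hy : 0 < y.re
    · obtain ⟨v, hv⟩ := exists_modApprox_limit hk hk' hy (y / 2)
      exact ⟨v, fun _ => hv⟩
    · exact ⟨0, fun h => absurd h hy⟩
  choose v hv using hex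
  have htwo : Tendsto (fun m : ℕ => 2 * m) atTop atTop :=
    tendsto_id.const_mul_atTop' two_pos
  have hfun : ∀ y : ℂ, 0 < y.re → v (y + 2) * (y + 2 / 3) ^ 3 = v y * (y + 4 / 3) ^ 3 := by
    intro y hy
    have hy2 : 0 < (y + 2).re := by simp; linarith
    have hne : ∀ r : ℝ, 0 < r → y + r ≠ 0 := fun r hr h => by
      have := congrArg Complex.re h
      rw [Complex.add_re, Complex.ofReal_re, Complex.zero_re] at this
      linarith
    have h1 := hne 1 one_pos
    have h4 := hne (4 / 3) (by norm_num)
    push_cast at h1 h4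
    set w : ℕ → ℂ := fun m => ((m : ℂ) + 1 / 3) ^ 3 /
      ((m : ℂ) ^ 2 + (y + 2) / 2 * m + ladderDen y) with hw
    have hev := eventually_re_tail_nonneg y (ladderDen y) hy
    have hhalf : Tendsto (fun n : ℕ => n / 2) atTop atTop :=
      Nat.tendsto_div_const_atTop two_ne_zero
    -- The ladder tails exist only at even indices 2m; n / 2 extends them to all n.
    have l1 := ((hv y hy).1 (fun n => w (n / 2)) (hhalf.eventually (hev.mono fun m h => h.2))).comp
      htwo
    have l2 := (((hv (y + 2) hy2).1 (fun _ => 0) (Eventually.of_forall fun _ => le_rfl)).comp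
      htwo).const_mul (ladderNum y / ladderDen y)
    have heq : v y = ladderNum y / ladderDen y * v (y + 2) := by
      refine tendsto_nhds_unique (l1.congr' ?_) l2
      filter_upwards [hev] with m hm
      simp only [Function.comp_apply, Nat.mul_div_cancel_left m two_pos]
      exact modApprox_ladder hodd' heven' h1 m hm.1
    rw [heq]
    unfold ladderNum ladderDen
    rw [div_div_div_cancel_right₀ (mul_ne_zero (by norm_num) h1), mul_right_comm,
      div_mul_cancel₀ _ (pow_ne_zero 3 h4), mul_comm]
  have hone := limit_mul_gammaCubeQuot hfun (fun y hy => (hv y hy).2) hx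
  refine ⟨v x, ⟨?_, ?_⟩, left_ne_zero_of_mul_eq_one hone, ?_⟩
  · refine Eventually.of_forall fun n => ?_
    rw [hcont, complexContFract_dens]
    exact contSeq_den_ne_zero hk hx n
  · refine ((hv x hx).1 (fun _ => 0) (Eventually.of_forall fun _ => le_rfl)).congr fun n => ?_
    rw [hcont, GenContFract.convs, complexContFract_nums, complexContFract_dens, modApprox]
    simp
  · exact eq_one_div_of_mul_eq_one_right hone
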